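/- Let $\Gamma$ be a non-elementary (i.e. not virtually cyclic) torsion-free hyperbolic group. For a group $G$ and a sequence of homomorphisms $h_i\colon G\to\Gamma$ ($i\in\mathbb N$), the stable kernel $\underrightarrow{\mathrm{Ker}}\,(h_i)$ is the set of all $g\in G$ with $h_i(g)=1$ for all but finitely many $i$; the sequence is stable if every $g\in G$ outside the stable kernel satisfies $h_i(g)\neq 1$ for all but finitely many $i$. (1) A strict $\Gamma$-limit group is a group isomorphic to $H/\underrightarrow{\mathrm{Ker}}\,(h_i)$, where $H=\langle x_1,\dots,x_n\mid \Sigma\rangle$ for some $n$ and some set $\Sigma$ of words in the free group $F(x_1,\dots,x_n)$, and $(h_i)$ is a stable sequence of homomorphisms $H\to\Gamma$ no two of which differ by an inner automorphism of $\Gamma$. Every strict $\Gamma$-limit group acts by isometries and without a global fixed point on a (non-empty) $\mathbb R$-tree. (2) Let $a_1,\dots,a_k$ be a finite generating family of $\Gamma$. A strict restricted $\Gamma$-limit group is a group $L$ isomorphic to $H/\underrightarrow{\mathrm{Ker}}\,(h_i)$, where $H=\langle x_1,\dots,x_n,a_1,\dots,a_k\mid\Sigma\rangle$ for some $n$ and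 some set $\Sigma$ of words in the free group $F(x_1,\dots,x_n,a_1,\dots,a_k)$, and $(h_i)$ is a stable sequence of pairwise distinct homomorphisms $H\to\Gamma$ with $h_i(a_m)=a_m$ for all $i$ and $m$; its coefficient subgroup is the image in $L$ of the subgroup of $H$ generated by $a_1,\dots,a_k$. Every strict restricted $\Gamma$-limit group acts by isometries and without a global fixed point on a (non-empty) $\mathbb R$-tree in such a way that its coefficient subgroup fixes a point. -/

import Mathlib

universe u v

noncomputable section

/-! ### Word metrics and hyperbolic groups -/

/-- The length of a shortest word in the letters `S ∪ S⁻¹` that represents `g`. -/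
def wordLength {G : Type*} [Group G] (S : Finset G) (g : G) : ℕ :=
  sInf {n : ℕ | ∃ w : List G, w.length = n ∧ (∀ s ∈ w, s ∈ S ∨ s⁻¹ ∈ S) ∧ w.prod = g}

/-- The (left-invariant) word metric `d(g, h) = |g⁻¹ h|`. -/
def wordDist {G : Type*} [Group G] (S : Finset G) (g h : G) : ℝ :=
  wordLength S (g⁻¹ * h)

/-- The Gromov product `(x | y)_w` for a distance function `d`. -/
def gromovProduct {X : Type*} (d : X → X → ℝ) (w x y : X) : ℝ :=
  (d x w + d y w - d x y) / 2

/-- Gromov's definition of a hyperbolic distance function. -/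
def IsGromovHyperbolic {X : Type*} (d : X → X → ℝ) : Prop :=
  ∃ δ : ℝ, ∀ w x y z : X,
    min (gromovProduct d w x y) (gromovProduct d w y z) - δ ≤ gromovProduct d w x z

/-- A (word-)hyperbolic group: a group with a finite generating set whose word metric is Gromov
hyperbolic. -/
def IsHyperbolicGroup (G : Type*) [Group G] : Prop :=
  ∃ S : Finset G, Subgroup.closure (S : Set G) = ⊤ ∧ IsGromovHyperbolic (wordDist S)

/-- A group is torsion-free if no non-trivial element has finite order. -/
def IsTorsionFreeGroup (G : Type*) [Group G] : Prop :=
  ∀ g : G, g ≠ 1 → ¬ IsOfFinOrder g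

/-- A group is elementary if it is virtually cyclic (finite, or virtually infinite cyclic). -/
def IsElementaryGroup (G : Type*) [Group G] : Prop :=
  ∃ Z : Subgroup G, IsCyclic Z ∧ Z.FiniteIndex

/-! ### Stable sequences of homomorphisms -/

/-- The stable kernel of a sequence of homomorphisms: the elements that all but finitely many of
them kill. -/
def stableKernel {G Γ : Type*} [Group G] [Group Γ] (h : ℕ → G →* Γ) : Subgroup G where
  carrier := {g | ∀ᶠ n in Filter.atTop, h n g = 1}
  one_mem' := by simp
  mul_mem' := by
    intro a b ha hb
    filter_upwards [ha, hb] with n h₁ h₂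
    simp [h₁, h₂]
  inv_mem' := by
    intro a ha
    filter_upwards [ha] with n h₁
    simp [h₁]

instance stableKernel_normal {G Γ : Type*} [Group G] [Group Γ] (h : ℕ → G →* Γ) :
    (stableKernel h).Normal where
  conj_mem := by
    intro a ha g
    filter_upwards [ha] with n h₁
    simp [h₁]

/-- A sequence is stable if every element outside its stable kernel is killed by only finitely
many of the homomorphisms. -/
def IsStableSeq {G Γ : Type*} [Group G] [Group Γ] (h : ℕ → G →* Γ) : Prop :=
  ∀ g : G, g ∈ stableKernel h ∨ ∀ᶠ n in Filter.atTop, h n g ≠ 1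

/-- Two homomorphisms to `Γ` are conjugate if they differ by an inner automorphism of `Γ`. -/
def AreConjugateHoms {G Γ : Type*} [Group G] [Group Γ] (f f' : G →* Γ) : Prop :=
  ∃ γ : Γ, ∀ g : G, f' g = γ * f g * γ⁻¹

/-! ### Limit groups -/

/-- `L` is a strict `Γ`-limit group: it is isomorphic to `H / stableKernel h`, where
`H = ⟨x₁, …, xₙ ∣ E⟩` is the group of a coefficient-free system of equations `E` in `n` variables
and `h` is a stable sequence of pairwise non-conjugate homomorphisms from `H` to `Γ`. -/
def IsStrictLimitGroup (Γ : Type*) [Group Γ] (L : Type*) [Group L] : Prop :=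
  ∃ (n : ℕ) (E : Set (FreeGroup (Fin n))) (h : ℕ → PresentedGroup E →* Γ),
    IsStableSeq h ∧
    (∀ i j : ℕ, i ≠ j → ¬ AreConjugateHoms (h i) (h j)) ∧
    Nonempty ((PresentedGroup E ⧸ stableKernel h) ≃* L)

/-- The coefficient subgroup of `⟨X, A ∣ E⟩`: the subgroup generated by (the image of) `A`. -/
def coefficientSubgroup {X A : Type*} (E : Set (FreeGroup (X ⊕ A))) :
    Subgroup (PresentedGroup E) :=
  Subgroup.closure (Set.range fun m : A => PresentedGroup.of (rels := E) (Sum.inr m))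

/-- `L` is a strict restricted `Γ`-limit group with coefficient subgroup `C`, where the
coefficients are the members `a₁, …, aₖ` of a finite generating family of `Γ`: there are a system
of equations with coefficients `E` in `n` variables, with group
`H = ⟨x₁, …, xₙ, a₁, …, aₖ ∣ E⟩`, a stable sequence `h` of pairwise distinct homomorphisms from
`H` to `Γ` that send each letter `aₘ` to the element `aₘ` of `Γ`, and an isomorphism from
`H / stableKernel h` to `L` that takes the image of the coefficient subgroup of `H` to `C`. -/
def IsStrictRestrictedLimitGroup {Γ : Type*} [Group Γ] {k : ℕ} (a : Fin k → Γ)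
    (L : Type*) [Group L] (C : Subgroup L) : Prop :=
  ∃ (n : ℕ) (E : Set (FreeGroup (Fin n ⊕ Fin k))) (h : ℕ → PresentedGroup E →* Γ),
    (∀ (i : ℕ) (m : Fin k), h i (PresentedGroup.of (Sum.inr m)) = a m) ∧
    IsStableSeq h ∧
    (∀ i j : ℕ, i ≠ j → h i ≠ h j) ∧
    ∃ e : (PresentedGroup E ⧸ stableKernel h) ≃* L,
      C = ((coefficientSubgroup E).map (QuotientGroup.mk' (stableKernel h))).map e.toMonoidHom

/-! ### Real trees -/

/-- `s` is a geodesic segment from `x` to `y`: the image of an isometric embedding of the interval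
`[0, d(x, y)]` that takes the endpoints to `x` and `y`. -/
def IsGeodesicSegment {T : Type*} [MetricSpace T] (x y : T) (s : Set T) : Prop :=
  ∃ γ : ℝ → T, γ 0 = x ∧ γ (dist x y) = y ∧
    (∀ p ∈ Set.Icc 0 (dist x y), ∀ q ∈ Set.Icc 0 (dist x y), dist (γ p) (γ q) = |p - q|) ∧
    γ '' Set.Icc 0 (dist x y) = s

/-- A (non-empty) `ℝ`-tree: any two points are joined by a unique geodesic segment, and two
geodesic segments that meet only in a common endpoint form together a geodesic segment. -/
structure IsRealTree (T : Type*) [MetricSpace T] : Prop where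
  nonempty : Nonempty T
  existsUnique_segment : ∀ x y : T, ∃! s : Set T, IsGeodesicSegment x y s
  segment_union : ∀ (x y z : T) (s t : Set T), IsGeodesicSegment y x s → IsGeodesicSegment x z t →
    s ∩ t = {x} → IsGeodesicSegment y z (s ∪ t)

end

/-! Both trees are asymptotic cones of `Γ`: the word metric is divided by r_i, the total length of
the `h i`-images of the generators of `H`, and an ultralimit is taken. Distinct homomorphisms force
r_i → ∞, so the hyperbolicity constant disappears and the cone is geodesic and 0-hyperbolic, hence a
real tree (`isRealTree_of_four_point`). Letting `h i g` act on the i-th coordinate gives an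
isometric action that factors through the quotient by the stable kernel (`exists_limit_tree`).

(1) Each h_i is first replaced by a conjugate of least total length. A global fixed point,
represented by (x_i), would mean that conjugation by x_i⁻¹ makes the total length o(r_i), against
minimality.

(2) Conjugation would destroy h_i(a_m) = a_m, so the base point b = [1] is kept. It is fixed by the
coefficients, since |a_m| / r_i → 0, but not by the whole group, since the normalised displacements
of the generators at b sum to 1. A global fixed point t = [x_i] would thus differ from b, and the
a_m would move 1 boundedly and x_i by only o(|x_i|). Along a geodesic from 1 to x_i the conjugates
of the a_m then stay in a fixed finite set, and the pigeonhole principle yields a non-trivial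
central element (`exists_mem_center_ne_one`). This is impossible: a long central element moves along
a quasi-axis that is coarsely all of `Γ`, so `Γ` would be virtually cyclic
(`isElementaryGroup_of_mem_center`). -/

open Filter Topology

/-! ### Word lengths, finite balls and discrete geodesics -/

section WordMetric

variable {G : Type*} [Group G] {S : Finset G}

theorem wordLength_le_of_word (w : List G) (hw : ∀ s ∈ w, s ∈ S ∨ s⁻¹ ∈ S) :
    wordLength S w.prod ≤ w.length :=
  Nat.sInf_le ⟨w, rfl, hw, rfl⟩

/-- Generation makes the set of lengths non-empty, so that `sInf` is attained and is not the default
value 0. -/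
theorem exists_word_length_eq (hS : Subgroup.closure (S : Set G) = ⊤) (g : G) :
    ∃ w : List G, w.length = wordLength S g ∧ (∀ s ∈ w, s ∈ S ∨ s⁻¹ ∈ S) ∧ w.prod = g := by
  have hg : g ∈ (Subgroup.closure (S : Set G)).toSubmonoid := by simp [hS]
  rw [Subgroup.closure_toSubmonoid] at hg
  obtain ⟨l, hl, hp⟩ := Submonoid.exists_list_of_mem_closure hg
  exact Nat.sInf_mem (s := {n : ℕ | ∃ w : List G, w.length = n ∧
    (∀ s ∈ w, s ∈ S ∨ s⁻¹ ∈ S) ∧ w.prod = g}) ⟨l.length, l, rfl, by simpa using hl, hp⟩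

theorem wordLength_one : wordLength S (1 : G) = 0 := by
  simpa using wordLength_le_of_word (S := S) [] (by simp)

theorem wordLength_mul_le (hS : Subgroup.closure (S : Set G) = ⊤) (g h : G) :
    wordLength S (g * h) ≤ wordLength S g + wordLength S h := by
  obtain ⟨v, hv, hv', rfl⟩ := exists_word_length_eq hS g
  obtain ⟨w, hw, hw', rfl⟩ := exists_word_length_eq hS h
  rw [← hv, ← hw, ← List.length_append, ← List.prod_append]
  refine wordLength_le_of_word _ fun s hs => ?_
  rcases List.mem_append.1 hs with hs | hs
  exacts [hv' s hs, hw' s hs]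

theorem wordLength_inv_le (hS : Subgroup.closure (S : Set G) = ⊤) (g : G) :
    wordLength S g⁻¹ ≤ wordLength S g := by
  obtain ⟨v, hv, hv', rfl⟩ := exists_word_length_eq hS g
  rw [← hv, List.prod_inv_reverse]
  refine (wordLength_le_of_word _ fun s hs => ?_).trans (by simp)
  obtain ⟨t, ht, rfl⟩ := List.mem_map.1 (List.mem_reverse.1 hs)
  simpa using (hv' t ht).symm

theorem wordLength_inv (hS : Subgroup.closure (S : Set G) = ⊤) (g : G) :
    wordLength S g⁻¹ = wordLength S g :=
  (wordLength_inv_le hS g).antisymm (by simpa using wordLength_inv_le hS g⁻¹)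

theorem finite_wordLength_le (hS : Subgroup.closure (S : Set G) = ⊤) (R : ℕ) :
    {g : G | wordLength S g ≤ R}.Finite := by
  have hA : ((S : Set G) ∪ (S : Set G)⁻¹).Finite := S.finite_toSet.union S.finite_toSet.inv
  have := hA.to_subtype
  refine ((List.finite_length_le ↥((S : Set G) ∪ (S : Set G)⁻¹) R).image
    fun l => (l.map Subtype.val).prod).subset fun g (hg : wordLength S g ≤ R) => ?_
  obtain ⟨w, hl, hw, rfl⟩ := exists_word_length_eq hS g
  have hw' : ∀ s ∈ w, s ∈ (S : Set G) ∪ (S : Set G)⁻¹ := by simpa using hw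
  exact ⟨w.attach.map fun s => ⟨s.1, hw' _ s.2⟩, by simpa [hl] using hg, by simp⟩

/-- Discrete geodesics in the word metric. -/
theorem exists_discrete_geodesic_from_one (hS : Subgroup.closure (S : Set G) = ⊤) (g : G) :
    ∃ p : ℕ → G, p 0 = 1 ∧ p (wordLength S g) = g ∧
      ∀ i j, i ≤ j → j ≤ wordLength S g → wordLength S ((p i)⁻¹ * p j) = j - i := by
  obtain ⟨w, hl, hw, hp⟩ := exists_word_length_eq hS g
  have hup : ∀ i j, i ≤ j → wordLength S (((w.take i).prod)⁻¹ * (w.take j).prod) ≤ j - i := by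
    intro i j hij
    have : (w.take j).prod = (w.take i).prod * ((w.take j).drop i).prod := by
      rw [← List.prod_append, List.drop_take, ← List.take_add, Nat.add_sub_cancel' hij]
    rw [this, inv_mul_cancel_left]
    refine (wordLength_le_of_word _ fun s hs => hw s ?_).trans ?_
    · exact List.mem_of_mem_take (List.mem_of_mem_drop hs)
    · simp; omega
  have hend : (w.take (wordLength S g)).prod = g := by rw [← hl, List.take_length, hp]
  refine ⟨fun i => (w.take i).prod, by simp, hend, fun i j hij hj => (hup i j hij).antisymm ?_⟩
  -- No stretch of a shortest word can be shortened: prefix, stretch and suffix have lengths at most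
  -- i, j - i and |g| - j, while together they must reach |g|.
  have h1 := hup 0 i (Nat.zero_le _)
  have h2 := hup j _ hj
  have h3 := wordLength_mul_le hS (w.take i).prod (((w.take i).prod)⁻¹ * (w.take j).prod)
  have h4 := wordLength_mul_le hS (w.take j).prod (((w.take j).prod)⁻¹ * g)
  rw [hend] at h2
  simp only [mul_inv_cancel_left, List.take_zero, List.prod_nil, inv_one, one_mul] at *
  omega

/-- The word metric as a pseudo-metric structure. -/
noncomputable abbrev wordPseudoMetricSpace (hS : Subgroup.closure (S : Set G) = ⊤) : PseudoMetricSpace G where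
  dist := wordDist S
  dist_self g := by simp [wordDist, wordLength_one]
  dist_comm g h := by
    rw [wordDist, wordDist, ← wordLength_inv hS]
    simp
  dist_triangle g h k := by
    have := wordLength_mul_le hS (g⁻¹ * h) (h⁻¹ * k)
    simp only [mul_assoc, mul_inv_cancel_left] at this
    simp only [wordDist]
    exact_mod_cast this

end WordMetric

/-! ### Central elements of hyperbolic groups -/

section HyperbolicGroup

variable {G : Type*} [Group G] {S : Finset G} {δ : ℝ}

theorem wordDist_mul_left (g h k : G) : wordDist S (g * h) (g * k) = wordDist S h k := by
  simp [wordDist, mul_assoc]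

theorem wordDist_comm (hS : Subgroup.closure (S : Set G) = ⊤) (g h : G) :
    wordDist S g h = wordDist S h g :=
  (wordPseudoMetricSpace hS).dist_comm g h

theorem wordDist_triangle (hS : Subgroup.closure (S : Set G) = ⊤) (g h k : G) :
    wordDist S g k ≤ wordDist S g h + wordDist S h k :=
  (wordPseudoMetricSpace hS).dist_triangle g h k

/-- The four-point form of hyperbolicity. -/
theorem four_point_wordDist (hδ : ∀ w x y z : G, min (gromovProduct (wordDist S) w x y) (gromovProduct (wordDist S) w y z)
      - δ ≤ gromovProduct (wordDist S) w x z) (x y z w : G) :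
    wordDist S x z + wordDist S y w ≤
      max (wordDist S x y + wordDist S z w) (wordDist S x w + wordDist S y z) + 2 * δ := by
  have h := hδ w x y z
  simp only [gromovProduct] at h
  rw [sub_le_iff_le_add, min_le_iff] at h
  rcases h with h | h
  · have := le_max_left (wordDist S x y + wordDist S z w) (wordDist S x w + wordDist S y z)
    linarith
  · have := le_max_right (wordDist S x y + wordDist S z w) (wordDist S x w + wordDist S y z)
    linarith

theorem wordDist_pow_pow (w : G) {i j : ℕ} (hij : i ≤ j) :
    wordDist S (w ^ i) (w ^ j) = wordLength S (w ^ (j - i)) := by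
  obtain ⟨k, rfl⟩ := Nat.exists_eq_add_of_le hij
  simp [wordDist, pow_add]

/-- Local quasi-geodesics `1, w, w², …` are quasi-geodesics. -/
theorem wordLength_pow_succ_ge (hδ : ∀ w x y z : G, min (gromovProduct (wordDist S) w x y) (gromovProduct (wordDist S) w y z)
      - δ ≤ gromovProduct (wordDist S) w x z) (hδ0 : 0 ≤ δ) {w : G} {c : ℝ} (hc0 : 0 ≤ c)
    (hc : 2 * (wordLength S w : ℝ) - wordLength S (w ^ 2) ≤ 2 * c)
    (hw : 2 * c + 2 * δ < wordLength S w) (n : ℕ) :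
    (wordLength S (w ^ n) : ℝ) + wordLength S w - wordLength S (w ^ (n + 1)) ≤ 2 * c + 2 * δ := by
  induction n with
  | zero => simp [wordLength_one]; linarith
  | succ n ih =>
    have h := four_point_wordDist hδ 1 (w ^ n) (w ^ (n + 1)) (w ^ (n + 2))
    rw [← pow_zero w, wordDist_pow_pow w (by omega), wordDist_pow_pow w (by omega),
      wordDist_pow_pow w (by omega), wordDist_pow_pow w (by omega), wordDist_pow_pow w (by omega),
      wordDist_pow_pow w (by omega)] at h
    simp only [Nat.sub_zero, show n + 2 - n = 2 by omega, show n + 2 - (n + 1) = 1 by omega,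
      show n + 1 - n = 1 by omega, pow_one, ← sub_le_iff_le_add, le_max_iff] at h
    -- The first alternative, combined with `ih` and `hc`, would give |w| ≤ 2c + 2δ, against `hw`;
    -- the second is the claim.
    rcases h with h | h <;> linarith

/-- The four-point inequality for 1, w^j, w^(j+1) and w^(j+k) with k > 0 extends the one-step
estimate to arbitrary splittings; its other alternative would force |w| ≤ 2c + 3δ. -/
theorem wordLength_pow_add_ge (hδ : ∀ w x y z : G, min (gromovProduct (wordDist S) w x y) (gromovProduct (wordDist S) w y z)
      - δ ≤ gromovProduct (wordDist S) w x z) (hδ0 : 0 ≤ δ) {w : G} {c : ℝ} (hc0 : 0 ≤ c)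
    (hc : 2 * (wordLength S w : ℝ) - wordLength S (w ^ 2) ≤ 2 * c)
    (hw : 2 * c + 3 * δ < wordLength S w) (j k : ℕ) :
    (wordLength S (w ^ j) : ℝ) + wordLength S (w ^ k) - wordLength S (w ^ (j + k)) ≤
      2 * c + 4 * δ := by
  obtain _ | k := k
  · simp [wordLength_one]; linarith
  have h1 := wordLength_pow_succ_ge hδ hδ0 hc0 hc (by linarith) j
  have h2 := wordLength_pow_succ_ge hδ hδ0 hc0 hc (by linarith) k
  have h := four_point_wordDist hδ 1 (w ^ j) (w ^ (j + 1)) (w ^ (j + (k + 1)))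
  rw [← pow_zero w, wordDist_pow_pow w (by omega), wordDist_pow_pow w (by omega),
    wordDist_pow_pow w (by omega), wordDist_pow_pow w (by omega), wordDist_pow_pow w (by omega),
    wordDist_pow_pow w (by omega)] at h
  simp only [Nat.sub_zero, show j + (k + 1) - j = k + 1 by omega,
    show j + (k + 1) - (j + 1) = k by omega,
    show j + 1 - j = 1 by omega, pow_one, ← sub_le_iff_le_add, le_max_iff] at h
  rcases h with h | h <;> linarith

/-- Each further factor w adds at least |w| - 2c - 2δ ≥ 1 to the length. -/
theorem le_wordLength_pow (hδ : ∀ w x y z : G, min (gromovProduct (wordDist S) w x y) (gromovProduct (wordDist S) w y z)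
      - δ ≤ gromovProduct (wordDist S) w x z) (hδ0 : 0 ≤ δ) {w : G} {c : ℝ} (hc0 : 0 ≤ c)
    (hc : 2 * (wordLength S w : ℝ) - wordLength S (w ^ 2) ≤ 2 * c)
    (hw : 2 * c + 2 * δ + 1 ≤ wordLength S w) (n : ℕ) : (n : ℝ) ≤ wordLength S (w ^ n) := by
  induction n with
  | zero => simp
  | succ n ih =>
    have := wordLength_pow_succ_ge hδ hδ0 hc0 hc (by linarith) n
    push_cast
    linarith

/-- A long central element moves along a quasi-geodesic. -/
theorem two_mul_wordLength_sub_le_of_mem_center (hS : Subgroup.closure (S : Set G) = ⊤)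
    (hδ : ∀ w x y z : G, min (gromovProduct (wordDist S) w x y) (gromovProduct (wordDist S) w y z)
      - δ ≤ gromovProduct (wordDist S) w x z) {w : G}
    (hwc : w ∈ Subgroup.center G) (hw : 4 * δ + 2 < wordLength S w) :
    2 * (wordLength S w : ℝ) - wordLength S (w ^ 2) ≤ 2 * (2 * δ) := by
  obtain ⟨p, hp0, hpw, hp⟩ := exists_discrete_geodesic_from_one hS w
  set D := wordLength S w with hD
  obtain ⟨a, ha1, ha2⟩ : ∃ a : ℕ, 2 * a ≤ D ∧ D ≤ 2 * a + 1 := ⟨D / 2, by omega, by omega⟩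
  set m := p a with hm
  have e1 : wordDist S 1 m = a := by
    have := hp 0 a (by omega) (by omega)
    rw [hp0] at this
    simp only [wordDist, hm, this]; simp
  have e2 : wordDist S m w = D - a := by
    have := hp a D (by omega) le_rfl
    rw [hpw] at this
    simp only [wordDist, hm, this]
    rw [Nat.cast_sub (by omega)]
  -- As w m = m w, the path m, w, w m has no backtracking: the Gromov product of m and w m at w is
  -- 0. Two uses of hyperbolicity carry this over to 1 and w², losing δ each time.
  have e3 : wordDist S m (w * m) = D := by
    rw [← Subgroup.mem_center_iff.1 hwc m]
    simp [wordDist, hD]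
  have e4 : wordDist S w (w * m) = a := by
    rw [← e1, ← wordDist_mul_left w 1 m, mul_one]
  have e5 : wordDist S (w * m) (w ^ 2) = D - a := by
    rw [sq, wordDist_mul_left, e2]
  have e6 : wordDist S w (w ^ 2) = D := by
    simp [wordDist, sq, hD]
  have e7 : wordDist S 1 w = D := by simp [wordDist, hD]
  have e8 : wordDist S 1 (w ^ 2) = wordLength S (w ^ 2) := by simp [wordDist]
  have h1 := hδ w m 1 (w * m)
  have h2 := hδ w 1 (w ^ 2) (w * m)
  simp only [gromovProduct, wordDist_comm hS (w * m) w, wordDist_comm hS (w ^ 2) w,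
    wordDist_comm hS m 1, wordDist_comm hS (w ^ 2) (w * m), e1, e2, e3, e4, e5, e6, e7, e8,
    sub_le_iff_le_add, min_le_iff] at h1 h2
  have ha1' : (2 * a : ℝ) ≤ D := by exact_mod_cast ha1
  have ha2' : (D : ℝ) ≤ 2 * a + 1 := by exact_mod_cast ha2
  rcases h1 with h1 | h1 <;> rcases h2 with h2 | h2 <;> linarith

theorem exists_le_and_lt_succ {f : ℕ → ℝ} {e : ℝ} (h0 : f 0 ≤ e) (N : ℕ) :
    ∃ j ≤ N, f j ≤ e ∧ (j = N ∨ e < f (j + 1)) := by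
  induction N with
  | zero => exact ⟨0, le_rfl, h0, Or.inl rfl⟩
  | succ N ih =>
    obtain ⟨j, hj, hje, rfl | h⟩ := ih
    · by_cases hlt : e < f (j + 1)
      · exact ⟨j, by omega, hje, Or.inr hlt⟩
      · exact ⟨j + 1, le_rfl, not_lt.1 hlt, Or.inl rfl⟩
    · exact ⟨j, by omega, hje, Or.inr h⟩

/-- Since w is central, the powers of w and their translate by y are quasi-geodesics at constant
distance |y|. On a long stretch, hyperbolicity brings their middles within a bound independent of y.
The threshold 7δ + 2 covers the earlier estimates with c = 2δ. -/
theorem exists_zpow_mul_wordLength_le (hS : Subgroup.closure (S : Set G) = ⊤)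
    (hδ : ∀ w x y z : G, min (gromovProduct (wordDist S) w x y) (gromovProduct (wordDist S) w y z)
      - δ ≤ gromovProduct (wordDist S) w x z) (hδ0 : 0 ≤ δ) {w : G}
    (hwc : w ∈ Subgroup.center G) (hw : 7 * δ + 2 < wordLength S w) (y : G) :
    ∃ k : ℤ, (wordLength S (y * w ^ k) : ℝ) ≤ wordLength S w + 22 * δ := by
  have hc := two_mul_wordLength_sub_le_of_mem_center hS hδ hwc (by linarith)
  have hgrow := le_wordLength_pow hδ hδ0 (by linarith) hc (by linarith)
  have hadd := wordLength_pow_add_ge hδ hδ0 (by linarith) hc (by linarith)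
  -- The stretch must be so long that the ends cannot interfere: at u the Gromov products of y with
  -- 1 and of Q with y Q exceed 6δ.
  obtain ⟨n, hn⟩ := exists_nat_gt ((wordLength S y : ℝ) + 6 * δ)
  have hn' := hn.trans_le (hgrow n)
  have hcm : ∀ (i : ℕ) (g : G), g * w ^ i = w ^ i * g := fun i g =>
    Subgroup.mem_center_iff.1 (Subgroup.pow_mem _ hwc i) g
  set u := y * w ^ n with hu
  set Q := w ^ (2 * n) with hQ
  have d1 : wordDist S 1 y = wordLength S y := by simp [wordDist]
  have d2 : wordDist S Q (y * Q) = wordLength S y := by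
    rw [hQ, hcm, ← d1]; nth_rw 1 [← mul_one (w ^ (2 * n))]; rw [wordDist_mul_left]
  have d3 : wordDist S y u = wordLength S (w ^ n) := by simp [wordDist, hu]
  have d4 : wordDist S u (y * Q) = wordLength S (w ^ n) := by
    rw [hu, wordDist_mul_left, hQ, wordDist_pow_pow w (by omega)]
    congr 3; omega
  have d5 : wordDist S y (y * Q) = wordLength S Q := by simp [wordDist]
  have d6 : wordDist S 1 Q = wordLength S Q := by simp [wordDist]
  have t1 := wordDist_triangle hS y 1 u
  have t2 := wordDist_triangle hS u Q (y * Q)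
  have hnn := hadd n n
  rw [← two_mul n] at hnn
  have h1 := hδ u y 1 (y * Q)
  have h2 := hδ u 1 Q (y * Q)
  simp only [gromovProduct, wordDist_comm hS y 1, wordDist_comm hS (y * Q) u,
    wordDist_comm hS Q u, d1, d2, d3, d4, d5, d6, sub_le_iff_le_add, min_le_iff] at h1 h2 t1 t2
  -- The Gromov product of y and y Q at u is at most 4δ; two steps of hyperbolicity bound that of 1
  -- and Q by 6δ, so u lies near the stretch from 1 to Q.
  have hef : wordDist S 1 u + wordDist S u Q ≤ wordLength S Q + 12 * δ := by
    rcases h1 with h1 | h1 <;> rcases h2 with h2 | h2 <;> linarith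
  have he0 : (0 : ℝ) ≤ wordDist S 1 u := by simp [wordDist]
  have hf0 : (0 : ℝ) ≤ wordDist S u Q := by simp [wordDist]
  -- w^j is chosen at about the distance of u from 1, up to one step |w|, and the four-point
  -- inequality then puts it near u.
  obtain ⟨j, hj, hje, hj'⟩ := exists_le_and_lt_succ (f := fun i => (wordLength S (w ^ i) : ℝ))
    (e := wordDist S 1 u) (by simpa [wordLength_one] using he0) (2 * n)
  have hje' : wordDist S 1 u ≤ wordLength S (w ^ j) + wordLength S w + 12 * δ := by
    rcases hj' with rfl | hj'
    · have : (0 : ℝ) ≤ wordLength S w := by positivity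
      linarith
    · have := wordLength_mul_le hS (w ^ j) w
      rw [← pow_succ] at this
      have : (wordLength S (w ^ (j + 1)) : ℝ) ≤ wordLength S (w ^ j) + wordLength S w := by
        exact_mod_cast this
      linarith
  have h3 := hadd j (2 * n - j)
  rw [show j + (2 * n - j) = 2 * n by omega] at h3
  have d7 : wordDist S (w ^ j) Q = wordLength S (w ^ (2 * n - j)) := wordDist_pow_pow w hj
  have d8 : wordDist S 1 (w ^ j) = wordLength S (w ^ j) := by simp [wordDist]
  have h4 := four_point_wordDist hδ u 1 (w ^ j) Q
  rw [wordDist_comm hS u 1, d6, d7, d8, ← sub_le_iff_le_add, le_max_iff] at h4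
  refine ⟨(n : ℤ) - j, ?_⟩
  have d9 : wordDist S u (w ^ j) = wordLength S (y * w ^ ((n : ℤ) - j)) := by
    rw [wordDist_comm hS, wordDist, hu, zpow_sub, zpow_natCast, zpow_natCast]
    congr 2
    have h5 := hcm j (y * w ^ n * (w ^ j)⁻¹)
    rw [inv_mul_cancel_right] at h5
    rw [h5, inv_mul_cancel_left, mul_assoc]
  rw [← d9]
  rcases h4 with h4 | h4 <;> linarith

/-- A torsion-free hyperbolic group with non-trivial centre is virtually cyclic. -/
theorem isElementaryGroup_of_mem_center (hyp : IsHyperbolicGroup G) (htf : IsTorsionFreeGroup G)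
    {z : G} (hz : z ∈ Subgroup.center G) (hz1 : z ≠ 1) : IsElementaryGroup G := by
  obtain ⟨S, hS, δ, hδ⟩ := hyp
  have hδ0 : 0 ≤ δ := by
    have := hδ 1 1 1 1
    simp only [min_self] at this
    linarith
  obtain ⟨R, hR⟩ := exists_nat_gt (7 * δ + 2)
  obtain ⟨n, hn⟩ : ∃ n : ℕ, R < wordLength S (z ^ n) := by
    by_contra! hcon
    have hinj : Function.Injective fun n : ℕ => z ^ n :=
      injective_pow_iff_not_isOfFinOrder.2 (htf z hz1)
    exact Set.infinite_range_of_injective hinj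
      ((finite_wordLength_le hS R).subset (Set.range_subset_iff.2 hcon))
  have hwc : z ^ n ∈ Subgroup.center G := Subgroup.pow_mem _ hz n
  have hw : 7 * δ + 2 < wordLength S (z ^ n) := hR.trans (by exact_mod_cast hn)
  obtain ⟨K, hK⟩ := exists_nat_ge ((wordLength S (z ^ n) : ℝ) + 22 * δ)
  refine ⟨Subgroup.zpowers (z ^ n), inferInstance, ?_⟩
  -- Every coset meets the ball of radius K, which is finite.
  have hfin := (finite_wordLength_le hS K).image (QuotientGroup.mk (s := Subgroup.zpowers (z ^ n)))
  have : Finite (G ⧸ Subgroup.zpowers (z ^ n)) := by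
    rw [← Set.finite_univ_iff]
    refine hfin.subset fun q _ => ?_
    obtain ⟨y, rfl⟩ := QuotientGroup.mk_surjective q
    obtain ⟨k, hk⟩ := exists_zpow_mul_wordLength_le hS hδ hδ0 hwc hw y
    refine ⟨y * (z ^ n) ^ k, ?_, ?_⟩
    · exact_mod_cast hk.trans hK
    · exact QuotientGroup.mk_mul_of_mem y (Subgroup.zpow_mem_zpowers _ k)
  exact Subgroup.finiteIndex_of_finite_quotient

/-- An isometry that moves the start of a long geodesic little, and its end not too much, moves
the initial part of the geodesic little. -/
theorem wordDist_mul_le_of_geodesic (hS : Subgroup.closure (S : Set G) = ⊤)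
    (hδ : ∀ w x y z : G, min (gromovProduct (wordDist S) w x y) (gromovProduct (wordDist S) w y z)
      - δ ≤ gromovProduct (wordDist S) w x z) (hδ0 : 0 ≤ δ) {a x y : G}
    (hx : wordDist S 1 x + wordDist S x y = wordDist S 1 y)
    (hlong : 2 * wordDist S 1 x + wordDist S y (a * y) ≤ wordDist S 1 y) :
    wordDist S x (a * x) ≤ wordDist S 1 a + 4 * δ := by
  have i1 : wordDist S a (a * x) = wordDist S 1 x := by
    simpa using wordDist_mul_left (S := S) a 1 x
  have i2 : wordDist S a (a * y) = wordDist S 1 y := by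
    simpa using wordDist_mul_left (S := S) a 1 y
  have i3 : wordDist S (a * x) (a * y) = wordDist S x y := wordDist_mul_left a x y
  have t1 := wordDist_triangle hS a 1 y
  have t2 := wordDist_triangle hS 1 a (a * x)
  have h1 := four_point_wordDist hδ (a * x) a y (a * y)
  rw [wordDist_comm hS (a * x) a] at h1
  rw [wordDist_comm hS a 1] at t1
  have h2 := four_point_wordDist hδ (a * x) 1 x y
  rw [wordDist_comm hS (a * x) x, wordDist_comm hS (a * x) 1] at h2
  rw [← sub_le_iff_le_add, le_max_iff] at h1 h2
  have h3 : (0 : ℝ) ≤ wordDist S 1 a := by simp [wordDist]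
  have h4 : (0 : ℝ) ≤ wordDist S 1 y := by simp [wordDist]
  rcases h1 with h1 | h1 <;> rcases h2 with h2 | h2 <;> linarith

/-- If the members of a generating family of a hyperbolic group fix both ends of arbitrarily long
segments coarsely, then the centre is non-trivial. -/
theorem exists_mem_center_ne_one (hS : Subgroup.closure (S : Set G) = ⊤)
    (hδ : ∀ w x y z : G, min (gromovProduct (wordDist S) w x y) (gromovProduct (wordDist S) w y z)
      - δ ≤ gromovProduct (wordDist S) w x z) {ι : Type*} [Finite ι] {a : ι → G}
    (ha : Subgroup.closure (Set.range a) = ⊤)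
    (hlong : ∀ R : ℝ, ∃ y : G, R ≤ wordDist S 1 y ∧
      ∀ m, R + wordDist S y (a m * y) ≤ wordDist S 1 y) :
    ∃ z ∈ Subgroup.center G, z ≠ 1 := by
  have hδ0 : 0 ≤ δ := by
    have := hδ 1 1 1 1
    simp only [min_self] at this
    linarith
  choose K hK using fun m => exists_nat_ge (wordDist S 1 (a m) + 4 * δ)
  have hF : (Set.univ.pi fun m => {g : G | wordLength S g ≤ K m}).Finite :=
    Set.Finite.pi fun m => finite_wordLength_le hS (K m)
  set M := hF.toFinset.card with hM
  -- M counts the tuples of conjugates that can occur, so the M + 1 points p 0, …, p M must repeat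
  -- one. The factor 2 meets the length hypothesis of `wordDist_mul_le_of_geodesic` for all t ≤ M.
  obtain ⟨y, hy, hya⟩ := hlong (2 * M)
  obtain ⟨p, hp0, hpy, hp⟩ := exists_discrete_geodesic_from_one hS y
  have hyN : wordDist S 1 y = wordLength S y := by simp [wordDist]
  have hMy : M ≤ wordLength S y := by
    have : (2 * M : ℝ) ≤ wordLength S y := hyN ▸ hy
    have : 2 * M ≤ wordLength S y := by exact_mod_cast this
    omega
  have hmaps : ∀ t ∈ Finset.range (M + 1), (fun m => (p t)⁻¹ * a m * p t) ∈ hF.toFinset := by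
    intro t ht
    have htM : t ≤ M := by simpa [Nat.lt_succ_iff] using ht
    rw [Set.Finite.mem_toFinset]
    intro m _
    have e1 : wordDist S 1 (p t) = t := by
      have := hp 0 t (by omega) (by omega)
      rw [hp0] at this
      simp only [wordDist, this]; simp
    have e2 : wordDist S (p t) y = wordLength S y - t := by
      have := hp t _ (htM.trans hMy) le_rfl
      rw [hpy] at this
      simp only [wordDist, this]
      rw [Nat.cast_sub (htM.trans hMy)]
    have htM' : (t : ℝ) ≤ M := by exact_mod_cast htM
    have h := wordDist_mul_le_of_geodesic hS hδ hδ0 (a := a m) (x := p t) (y := y)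
      (by rw [e1, e2, hyN]; ring) (by rw [e1]; linarith [hya m])
    have h' := h.trans (hK m)
    rw [wordDist, ← mul_assoc] at h'
    exact_mod_cast h'
  obtain ⟨s, hs, t, ht, hst, heq⟩ :=
    Finset.exists_ne_map_eq_of_card_lt_of_maps_to (by simp [hM]) hmaps
  refine ⟨p t * (p s)⁻¹, ?_, ?_⟩
  · rw [Subgroup.mem_center_iff]
    have hcent : Subgroup.closure (Set.range a) ≤ Subgroup.centralizer {p t * (p s)⁻¹} := by
      rw [Subgroup.closure_le]
      rintro _ ⟨m, rfl⟩
      rw [SetLike.mem_coe, Subgroup.mem_centralizer_singleton_iff]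
      have hm : (p s)⁻¹ * a m * p s = (p t)⁻¹ * a m * p t := congrFun heq m
      have : (p s)⁻¹ * a m = (p t)⁻¹ * a m * p t * (p s)⁻¹ := by rw [← hm]; group
      rw [mul_assoc (p t), this]; group
    intro g
    have hg : g ∈ Subgroup.centralizer {p t * (p s)⁻¹} := hcent (ha ▸ Subgroup.mem_top g)
    exact Subgroup.mem_centralizer_singleton_iff.1 hg
  · intro h1
    have hts : p t = p s := mul_inv_eq_one.1 h1
    simp only [Finset.mem_range] at hs ht
    rcases lt_or_gt_of_ne hst with hlt | hlt
    · have := hp s t hlt.le (by omega)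
      rw [hts, inv_mul_cancel, wordLength_one] at this
      omega
    · have := hp t s hlt.le (by omega)
      rw [hts, inv_mul_cancel, wordLength_one] at this
      omega

end HyperbolicGroup

/-! ### Geodesic 0-hyperbolic spaces are real trees -/

section RealTree

variable {T : Type*} [MetricSpace T]

theorem IsGeodesicSegment.exists_mem_dist {x y : T} {s : Set T} (hs : IsGeodesicSegment x y s)
    {c : ℝ} (hc : 0 ≤ c) (hc' : c ≤ dist x y) :
    ∃ p ∈ s, dist x p = c ∧ dist x p + dist p y = dist x y := by
  obtain ⟨γ, h0, h1, hγ, rfl⟩ := hs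
  have e1 : dist x (γ c) = c := by
    have := hγ 0 ⟨le_rfl, dist_nonneg⟩ c ⟨hc, hc'⟩
    rwa [h0, zero_sub, abs_neg, abs_of_nonneg hc] at this
  have e2 : dist (γ c) y = dist x y - c := by
    have := hγ c ⟨hc, hc'⟩ _ ⟨dist_nonneg, le_rfl⟩
    rwa [h1, abs_sub_comm, abs_of_nonneg (by linarith)] at this
  exact ⟨γ c, ⟨c, ⟨hc, hc'⟩, rfl⟩, e1, by rw [e1, e2]; ring⟩

theorem IsGeodesicSegment.dist_add_dist {x y z : T} {s : Set T} (hs : IsGeodesicSegment x y s)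
    (hz : z ∈ s) : dist x z + dist z y = dist x y := by
  obtain ⟨γ, h0, h1, hγ, rfl⟩ := hs
  obtain ⟨c, hc, rfl⟩ := hz
  have e1 := hγ 0 ⟨le_rfl, dist_nonneg⟩ c hc
  have e2 := hγ c hc _ ⟨dist_nonneg, le_rfl⟩
  rw [h0, zero_sub, abs_neg, abs_of_nonneg hc.1] at e1
  rw [h1, abs_sub_comm, abs_of_nonneg (by linarith [hc.2])] at e2
  rw [e1, e2]; ring

/-- Points of a `0`-hyperbolic space that lie between `x` and `y` are determined by their distance
to `x`. -/
theorem eq_of_dist_add_dist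
    (h4 : ∀ x y z w : T, dist x z + dist y w ≤ max (dist x y + dist z w) (dist x w + dist y z))
    {x y p q : T} (hp : dist x p + dist p y = dist x y) (hq : dist x q + dist q y = dist x y)
    (hpq : dist x p = dist x q) : p = q := by
  have h := h4 p x q y
  rw [dist_comm p x] at h
  rw [← dist_le_zero]
  rcases le_max_iff.1 h with h | h <;> linarith

theorem IsGeodesicSegment.eq_setOf
    (h4 : ∀ x y z w : T, dist x z + dist y w ≤ max (dist x y + dist z w) (dist x w + dist y z))
    {x y : T} {s : Set T} (hs : IsGeodesicSegment x y s) :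
    s = {z | dist x z + dist z y = dist x y} := by
  refine Set.Subset.antisymm (fun z hz => hs.dist_add_dist hz) fun z hz => ?_
  obtain ⟨p, hp, hp1, hp2⟩ := hs.exists_mem_dist (c := dist x z) dist_nonneg
    (by rw [← hz.out]; linarith [dist_nonneg (x := z) (y := y)])
  rwa [← eq_of_dist_add_dist h4 hp2 hz hp1]

/-- A non-empty geodesic `0`-hyperbolic metric space is a real tree. -/
theorem isRealTree_of_four_point [Nonempty T]
    (h4 : ∀ x y z w : T, dist x z + dist y w ≤ max (dist x y + dist z w) (dist x w + dist y z))
    (hgeo : ∀ x y : T, ∃ s, IsGeodesicSegment x y s) : IsRealTree T where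
  nonempty := inferInstance
  existsUnique_segment x y := by
    obtain ⟨s, hs⟩ := hgeo x y
    exact ⟨s, hs, fun t ht => by rw [ht.eq_setOf h4, hs.eq_setOf h4]⟩
  segment_union x y z s t hs ht hst := by
    have hadd : dist y x + dist x z = dist y z := by
      refine le_antisymm ?_ (dist_triangle _ _ _)
      by_contra! hlt
      have t1 := dist_triangle y z x
      have t2 := dist_triangle z y x
      rw [dist_comm z x] at t1 t2
      rw [dist_comm z y] at t2
      -- c is the Gromov product of y and z at x. Up to distance c from x the two segments coincide,
      -- so c > 0 would give a second common point.
      set c := (dist y x + dist x z - dist y z) / 2 with hc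
      obtain ⟨p, hp, hp1, hp2⟩ := hs.exists_mem_dist (c := dist y x - c) (by linarith)
        (by linarith)
      obtain ⟨q, hq, hq1, hq2⟩ := ht.exists_mem_dist (c := c) (by linarith) (by linarith)
      have h1 := h4 p y z x
      have h2 := h4 p z q x
      have hpq : p = q := by
        rw [← dist_le_zero]
        rw [dist_comm p y, dist_comm z x] at h1
        rw [dist_comm z x, dist_comm z q, dist_comm q x] at h2
        rcases le_max_iff.1 h1 with h1 | h1 <;> rcases le_max_iff.1 h2 with h2 | h2 <;> linarith
      have hpx : p ∈ s ∩ t := ⟨hp, hpq ▸ hq⟩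
      rw [hst, Set.mem_singleton_iff] at hpx
      rw [hpx] at hp1
      linarith
    obtain ⟨u, hu⟩ := hgeo y z
    suffices h : s ∪ t = u by rwa [h]
    rw [hu.eq_setOf h4]
    ext w
    constructor
    · rintro (hw | hw)
      · have h1 := hs.dist_add_dist hw
        have h2 := dist_triangle w x z
        have h3 := dist_triangle y w z
        exact le_antisymm (by linarith) h3
      · have h1 := ht.dist_add_dist hw
        have h2 := dist_triangle y x w
        have h3 := dist_triangle y w z
        exact le_antisymm (by linarith) h3
    · intro hw
      have hw' : dist y w + dist w z = dist y z := hw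
      rcases le_total (dist y w) (dist y x) with hle | hle
      · obtain ⟨p, hp, hp1, hp2⟩ := hs.exists_mem_dist dist_nonneg hle
        refine Or.inl ?_
        have h2 := dist_triangle p x z
        have h3 := dist_triangle y p z
        rwa [← eq_of_dist_add_dist h4 (le_antisymm (by linarith) h3) hw' hp1]
      · obtain ⟨p, hp, hp1, hp2⟩ := ht.exists_mem_dist (c := dist y w - dist y x) (by linarith)
          (by linarith [dist_nonneg (x := w) (y := z)])
        refine Or.inr ?_
        have h2 := dist_triangle y x p
        have h3 := dist_triangle y p z
        rwa [← eq_of_dist_add_dist h4 (le_antisymm (by linarith) h3) hw' (by linarith)]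

end RealTree

/-! ### Asymptotic cones -/

section Cone

/-- The limit of a bounded real sequence along a fixed non-principal ultrafilter. -/
noncomputable def ulim (f : ℕ → ℝ) : ℝ :=
  limUnder (hyperfilter ℕ : Filter ℕ) f

theorem tendsto_ulim {f : ℕ → ℝ} {a b : ℝ} (hf : ∀ i, f i ∈ Set.Icc a b) :
    Tendsto f (hyperfilter ℕ : Filter ℕ) (𝓝 (ulim f)) := by
  obtain ⟨x, -, hx⟩ := isCompact_Icc.ultrafilter_le_nhds ((hyperfilter ℕ).map f)
    (le_principal_iff.2 (Ultrafilter.mem_map.2 (Filter.univ_mem' hf)) :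
      ↑((hyperfilter ℕ).map f) ≤ 𝓟 (Set.Icc a b))
  exact tendsto_nhds_limUnder ⟨x, hx⟩

variable {X : Type*} [PseudoMetricSpace X] (o : X) (r : ℕ → ℕ)

/-- Sequences in `X` whose distance to `o` is at most a multiple of `r`. -/
@[ext]
structure ScaledSeq where
  seq : ℕ → X
  bounded : ∃ C : ℝ, ∀ i, dist o (seq i) / r i ≤ C

variable {o r}

theorem ScaledSeq.exists_dist_le (x y : ScaledSeq o r) :
    ∃ C : ℝ, ∀ i, dist (x.seq i) (y.seq i) / r i ∈ Set.Icc 0 C := by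
  obtain ⟨x, C, hC⟩ := x
  obtain ⟨y, D, hD⟩ := y
  refine ⟨C + D, fun i => ⟨by positivity, ?_⟩⟩
  calc dist (x i) (y i) / r i ≤ (dist o (x i) + dist o (y i)) / r i := by
        gcongr; exact dist_triangle_left _ _ _
    _ ≤ C + D := by rw [add_div]; exact add_le_add (hC i) (hD i)

/-- The distance between scaled sequences, measured in multiples of `r`. -/
noncomputable instance : PseudoMetricSpace (ScaledSeq o r) where
  dist x y := ulim fun i => dist (x.seq i) (y.seq i) / r i
  dist_self x := by simp [ulim, tendsto_const_nhds.limUnder_eq]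
  dist_comm x y := by simp only [dist_comm]
  dist_triangle x y z := by
    obtain ⟨A, hA⟩ := x.exists_dist_le y
    obtain ⟨B, hB⟩ := y.exists_dist_le z
    obtain ⟨C, hC⟩ := x.exists_dist_le z
    refine le_of_tendsto_of_tendsto' (tendsto_ulim hC) ((tendsto_ulim hA).add (tendsto_ulim hB))
      fun i => ?_
    rw [← add_div]
    gcongr
    exact dist_triangle _ _ _

theorem ScaledSeq.tendsto_dist (x y : ScaledSeq o r) :
    Tendsto (fun i => dist (x.seq i) (y.seq i) / r i) (hyperfilter ℕ : Filter ℕ) (𝓝 (dist x y)) :=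
  tendsto_ulim (x.exists_dist_le y).choose_spec

variable (o r) in
/-- The asymptotic cone of `X` with base point `o` and scaling factors `r`. -/
abbrev Cone : Type _ :=
  SeparationQuotient (ScaledSeq o r)

/-- After rescaling the error is 2δ / r_i, which tends to 0. -/
theorem Cone.four_point {δ : ℝ}
    (hδ : ∀ x y z w : X, dist x z + dist y w ≤
      max (dist x y + dist z w) (dist x w + dist y z) + 2 * δ)
    (hr : Tendsto (fun i => (r i : ℝ)) (hyperfilter ℕ : Filter ℕ) atTop) (x y z w : Cone o r) :
    dist x z + dist y w ≤ max (dist x y + dist z w) (dist x w + dist y z) := by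
  obtain ⟨x, rfl⟩ := SeparationQuotient.surjective_mk x
  obtain ⟨y, rfl⟩ := SeparationQuotient.surjective_mk y
  obtain ⟨z, rfl⟩ := SeparationQuotient.surjective_mk z
  obtain ⟨w, rfl⟩ := SeparationQuotient.surjective_mk w
  simp only [SeparationQuotient.dist_mk]
  have hl := (x.tendsto_dist z).add (y.tendsto_dist w)
  have hr := (((x.tendsto_dist y).add (z.tendsto_dist w)).max
    ((x.tendsto_dist w).add (y.tendsto_dist z))).add (hr.const_div_atTop (2 * δ))
  rw [add_zero] at hr
  refine le_of_tendsto_of_tendsto' hl hr fun i => ?_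
  simp only [← add_div]
  rw [max_div_div_right (by positivity), ← add_div]
  exact div_le_div_of_nonneg_right (hδ _ _ _ _) (by positivity)

/-- Discrete geodesics between the coordinates, reparametrised at speed r_i, converge to a geodesic
of the cone. -/
theorem Cone.exists_isGeodesicSegment
    (hX : ∀ x y : X, ∃ (n : ℕ) (p : ℕ → X), dist x y = n ∧ p 0 = x ∧ p n = y ∧
      ∀ i j, i ≤ j → j ≤ n → dist (p i) (p j) = j - i)
    (hr : Tendsto (fun i => (r i : ℝ)) (hyperfilter ℕ : Filter ℕ) atTop) (x y : Cone o r) :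
    ∃ s, IsGeodesicSegment x y s := by
  obtain ⟨x, rfl⟩ := SeparationQuotient.surjective_mk x
  obtain ⟨y, rfl⟩ := SeparationQuotient.surjective_mk y
  choose n p hn hp0 hpn hp using fun i => hX (x.seq i) (y.seq i)
  have hp' : ∀ i j k, j ≤ n i → k ≤ n i → dist (p i j) (p i k) = |(j : ℝ) - k| := by
    intro i j k hj hk
    rcases le_total j k with h | h
    · rw [hp i j k h hk, abs_sub_comm, abs_of_nonneg (sub_nonneg.2 (by exact_mod_cast h))]
    · rw [dist_comm, hp i k j h hj, abs_of_nonneg (sub_nonneg.2 (by exact_mod_cast h))]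
  obtain ⟨C, hC⟩ := x.exists_dist_le y
  obtain ⟨C', hC'⟩ := x.bounded
  let q : ℝ → ℕ → ℕ := fun t i => min ⌊t * r i⌋₊ (n i)
  let γ : ℝ → ScaledSeq o r := fun t => ⟨fun i => p i (q t i), C' + C, fun i => by
    calc dist o (p i (q t i)) / r i ≤ (dist o (x.seq i) + dist (x.seq i) (y.seq i)) / r i := by
          gcongr
          refine (dist_triangle _ (x.seq i) _).trans ?_
          gcongr
          rw [← hp0, hp i 0 _ (Nat.zero_le _) (min_le_right _ _), hp0, hn]
          simp
      _ ≤ C' + C := by rw [add_div]; exact add_le_add (hC' i) (hC i).2⟩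
  set D := dist x y with hD
  have hq : ∀ t, 0 ≤ t → t ≤ D →
      Tendsto (fun i => (q t i : ℝ) / r i) (hyperfilter ℕ : Filter ℕ) (𝓝 t) := by
    intro t ht htD
    have h1 : Tendsto (fun i => (⌊t * r i⌋₊ : ℝ) / r i) (hyperfilter ℕ : Filter ℕ) (𝓝 t) :=
      (tendsto_nat_floor_mul_div_atTop ht).comp hr
    have h2 := h1.min (x.tendsto_dist y)
    rw [← hD, min_eq_left htD] at h2
    refine h2.congr fun i => ?_
    rw [min_div_div_right (by positivity), hn]
    simp [q]
  have hD0 : 0 ≤ D := dist_nonneg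
  have hγ : ∀ s ∈ Set.Icc 0 D, ∀ t ∈ Set.Icc 0 D, dist (γ s) (γ t) = |s - t| := by
    intro s hs t ht
    refine tendsto_nhds_unique ((γ s).tendsto_dist (γ t))
      ((((hq s hs.1 hs.2).sub (hq t ht.1 ht.2)).abs).congr fun i => ?_)
    rw [← sub_div, abs_div, Nat.abs_cast]
    congr 1
    exact (hp' i _ _ (min_le_right _ _) (min_le_right _ _)).symm
  have hend : dist (γ D) y = 0 := by
    refine tendsto_nhds_unique ((γ D).tendsto_dist y) ?_
    have h := ((hq D hD0 le_rfl).sub (x.tendsto_dist y)).abs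
    rw [sub_self, abs_zero] at h
    refine h.congr fun i => ?_
    rw [← sub_div, abs_div, Nat.abs_cast, hn]
    congr 1
    rw [← hp' i _ _ (min_le_right _ _) le_rfl, hpn]
  refine ⟨_, fun t => SeparationQuotient.mk (γ t), ?_, ?_, ?_, rfl⟩
  · refine congrArg SeparationQuotient.mk (ScaledSeq.ext (funext fun i => ?_))
    simp [γ, q, hp0]
  · rw [SeparationQuotient.dist_mk, ← dist_eq_zero, SeparationQuotient.dist_mk]
    exact hend
  · simpa only [SeparationQuotient.dist_mk] using hγ

end Cone

/-! ### The limit action on the cone -/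

section Action

/-- The sequence obtained by letting `h i g` act on the `i`-th member. -/
def ScaledSeq.twist {Γ G X : Type*} [Group Γ] [Group G] [PseudoMetricSpace X] [MulAction Γ X]
    [IsIsometricSMul Γ X] {o : X} {r : ℕ → ℕ} {h : ℕ → G →* Γ}
    (hb : ∀ g, ∃ C : ℝ, ∀ i, dist o (h i g • o) / r i ≤ C) (g : G) (x : ScaledSeq o r) :
    ScaledSeq o r where
  seq i := h i g • x.seq i
  bounded := by
    obtain ⟨C, hC⟩ := hb g
    obtain ⟨D, hD⟩ := x.bounded
    refine ⟨C + D, fun i => ?_⟩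
    calc dist o (h i g • x.seq i) / r i ≤ (dist o (h i g • o) + dist o (x.seq i)) / r i := by
          gcongr
          refine (dist_triangle _ (h i g • o) _).trans ?_
          rw [dist_smul]
      _ ≤ C + D := by rw [add_div]; exact add_le_add (hC i) (hD i)

variable {Γ G X : Type*} [Group Γ] [Group G] [PseudoMetricSpace X] [MulAction Γ X]
    [IsIsometricSMul Γ X] {o : X} {r : ℕ → ℕ} {h : ℕ → G →* Γ}

theorem ScaledSeq.dist_twist (hb : ∀ g, ∃ C : ℝ, ∀ i, dist o (h i g • o) / r i ≤ C) (g : G)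
    (x y : ScaledSeq o r) : dist (x.twist hb g) (y.twist hb g) = dist x y := by
  simp only [dist, ScaledSeq.twist]
  congr 1
  funext i
  exact congrArg (· / (r i : ℝ)) (dist_smul (h i g) (x.seq i) (y.seq i))

theorem ScaledSeq.isometry_twist (hb : ∀ g, ∃ C : ℝ, ∀ i, dist o (h i g • o) / r i ≤ C) (g : G) :
    Isometry (ScaledSeq.twist (o := o) (r := r) hb g) :=
  Isometry.of_dist_eq (ScaledSeq.dist_twist hb g)

/-- The limit action of `G` on the asymptotic cone. -/
noncomputable abbrev Cone.mulAction (hb : ∀ g, ∃ C : ℝ, ∀ i, dist o (h i g • o) / r i ≤ C) :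
    MulAction G (Cone o r) where
  smul g := SeparationQuotient.lift (fun x => SeparationQuotient.mk (ScaledSeq.twist hb g x))
    fun x y hxy => by
      rw [SeparationQuotient.mk_eq_mk]
      exact hxy.map (ScaledSeq.isometry_twist hb g).continuous
  one_smul x := by
    obtain ⟨x, rfl⟩ := SeparationQuotient.surjective_mk x
    refine congrArg SeparationQuotient.mk (ScaledSeq.ext (funext fun i => ?_))
    simp [ScaledSeq.twist]
  mul_smul g g' x := by
    obtain ⟨x, rfl⟩ := SeparationQuotient.surjective_mk x
    refine congrArg SeparationQuotient.mk (ScaledSeq.ext (funext fun i => ?_))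
    simp [ScaledSeq.twist, mul_smul]

/-- The limit action, as a homomorphism. -/
noncomputable def Cone.toPerm (hb : ∀ g, ∃ C : ℝ, ∀ i, dist o (h i g • o) / r i ≤ C) :
    G →* Equiv.Perm (Cone o r) :=
  letI := Cone.mulAction hb
  MulAction.toPermHom G (Cone o r)

theorem Cone.toPerm_mk (hb : ∀ g, ∃ C : ℝ, ∀ i, dist o (h i g • o) / r i ≤ C) (g : G)
    (x : ScaledSeq o r) :
    Cone.toPerm hb g (SeparationQuotient.mk x) = SeparationQuotient.mk (x.twist hb g) :=
  rfl

/-- Such an element acts trivially on all but finitely many coordinates, and a non-principal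
ultrafilter ignores the rest. -/
theorem Cone.stableKernel_le_ker_toPerm
    (hb : ∀ g, ∃ C : ℝ, ∀ i, dist o (h i g • o) / r i ≤ C) :
    stableKernel h ≤ (Cone.toPerm hb).ker := by
  intro g hg
  rw [MonoidHom.mem_ker]
  ext x
  obtain ⟨x, rfl⟩ := SeparationQuotient.surjective_mk x
  rw [Cone.toPerm_mk, Equiv.Perm.one_apply, ← dist_eq_zero, SeparationQuotient.dist_mk]
  refine tendsto_nhds_unique ((x.twist hb g).tendsto_dist x) (tendsto_const_nhds.congr' ?_)
  have hg' : ∀ᶠ n in atTop, h n g = 1 := hg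
  filter_upwards [Nat.hyperfilter_le_atTop hg'] with i hi
  simp [ScaledSeq.twist, hi]

/-- The limit action of the quotient by the stable kernel. -/
theorem Cone.exists_quotient_action {L : Type*} [Group L]
    (hb : ∀ g, ∃ C : ℝ, ∀ i, dist o (h i g • o) / r i ≤ C) (e : (G ⧸ stableKernel h) ≃* L) :
    ∃ _ : MulAction L (Cone o r), IsIsometricSMul L (Cone o r) ∧
      ∀ (g : G) (x : ScaledSeq o r), e (QuotientGroup.mk g) • (SeparationQuotient.mk x : Cone o r) =
        SeparationQuotient.mk (x.twist hb g) := by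
  let ρ : L →* Equiv.Perm (Cone o r) :=
    (QuotientGroup.lift _ (Cone.toPerm hb) (Cone.stableKernel_le_ker_toPerm hb)).comp
      e.symm.toMonoidHom
  have hρ : ∀ (g : G) (x : ScaledSeq o r), ρ (e (QuotientGroup.mk g)) (SeparationQuotient.mk x) =
      SeparationQuotient.mk (x.twist hb g) := by
    intro g x
    simp [ρ, Cone.toPerm_mk]
  let _ : MulAction L (Cone o r) := MulAction.compHom _ ρ
  refine ⟨inferInstance, ⟨fun l => Isometry.of_dist_eq fun x y => ?_⟩, hρ⟩
  obtain ⟨q, rfl⟩ := e.surjective l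
  obtain ⟨g, rfl⟩ := QuotientGroup.mk_surjective q
  obtain ⟨x, rfl⟩ := SeparationQuotient.surjective_mk x
  obtain ⟨y, rfl⟩ := SeparationQuotient.surjective_mk y
  change dist (ρ _ _) (ρ _ _) = _
  rw [hρ, hρ, SeparationQuotient.dist_mk, SeparationQuotient.dist_mk, ScaledSeq.dist_twist]

end Action

/-! ### Growth of the scaling factors -/

section Displacement

variable {Γ : Type*} [Group Γ] {S : Finset Γ} {G : Type*} [Group G] {ι : Type*} [Fintype ι]

/-- The sum of the lengths of the images of a family of elements. -/
noncomputable def totalLength (S : Finset Γ) (y : ι → G) (f : G →* Γ) : ℕ :=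
  ∑ j, wordLength S (f (y j))

/-- A homomorphism is determined by the images of the generators, which lie in a finite ball. -/
theorem finite_totalLength_le (hS : Subgroup.closure (S : Set Γ) = ⊤) {y : ι → G}
    (hy : Subgroup.closure (Set.range y) = ⊤) (R : ℕ) :
    {f : G →* Γ | totalLength S y f ≤ R}.Finite := by
  refine Set.Finite.of_finite_image (f := fun f : G →* Γ => fun j => f (y j))
    ((Set.Finite.pi' fun _ => finite_wordLength_le hS R).subset ?_) ?_
  · rintro _ ⟨f, hf, rfl⟩ j
    exact (Finset.single_le_sum (f := fun j => wordLength S (f (y j))) (fun _ _ => Nat.zero_le _)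
      (Finset.mem_univ j)).trans hf
  · intro f _ f' _ hff
    refine MonoidHom.eq_of_eqOn_dense hy ?_
    rintro _ ⟨j, rfl⟩
    exact congrFun hff j

theorem tendsto_totalLength (hS : Subgroup.closure (S : Set Γ) = ⊤) {y : ι → G}
    (hy : Subgroup.closure (Set.range y) = ⊤) {h : ℕ → G →* Γ} (hh : Function.Injective h) :
    Tendsto (fun i => (totalLength S y (h i) : ℝ)) (hyperfilter ℕ : Filter ℕ) atTop := by
  have h1 : Tendsto (fun i => totalLength S y (h i)) cofinite atTop := by
    refine Filter.tendsto_atTop.2 fun R => ?_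
    rw [eventually_cofinite]
    refine ((finite_totalLength_le hS hy R).preimage hh.injOn).subset fun i hi => ?_
    exact (not_le.1 hi).le
  exact tendsto_natCast_atTop_atTop.comp (h1.mono_left (hyperfilter_le_cofinite))

theorem exists_wordLength_div_totalLength_le (hS : Subgroup.closure (S : Set Γ) = ⊤) {y : ι → G}
    (hy : Subgroup.closure (Set.range y) = ⊤) (h : ℕ → G →* Γ) (g : G) :
    ∃ C : ℝ, ∀ i, (wordLength S (h i g) : ℝ) / totalLength S y (h i) ≤ C := by
  have hg : g ∈ Subgroup.closure (Set.range y) := hy ▸ Subgroup.mem_top g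
  induction hg using Subgroup.closure_induction with
  | mem g hg =>
    obtain ⟨j, rfl⟩ := hg
    -- The bound also holds when the total length is 0, since the quotient is then 0 by convention.
    refine ⟨1, fun i => div_le_one_of_le₀ ?_ (by positivity)⟩
    exact_mod_cast Finset.single_le_sum (f := fun j => wordLength S (h i (y j)))
      (fun _ _ => Nat.zero_le _) (Finset.mem_univ j)
  | one => exact ⟨0, fun i => by simp [wordLength_one]⟩
  | mul a b _ _ ha hb =>
    obtain ⟨A, hA⟩ := ha
    obtain ⟨B, hB⟩ := hb
    refine ⟨A + B, fun i => le_trans ?_ (add_le_add (hA i) (hB i))⟩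
    rw [← add_div, map_mul]
    gcongr
    exact_mod_cast wordLength_mul_le hS _ _
  | inv a _ ha =>
    obtain ⟨A, hA⟩ := ha
    exact ⟨A, fun i => by rw [map_inv, wordLength_inv hS]; exact hA i⟩

end Displacement

/-! ### Assembling the limit tree -/

section LimitTree

variable {Γ : Type u} [Group Γ] {S : Finset Γ} {δ : ℝ} {G : Type*} [Group G] {ι : Type*}
  [Fintype ι] {L : Type*} [Group L]

/-- The limit tree of a sequence of distinct homomorphisms from a finitely generated group to a
hyperbolic group. Its points are limits of sequences `x : ℕ → Γ`; the stated formulas compute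
the displacements of group elements. -/
theorem exists_limit_tree (hS : Subgroup.closure (S : Set Γ) = ⊤)
    (hδ : ∀ w x y z : Γ, min (gromovProduct (wordDist S) w x y) (gromovProduct (wordDist S) w y z)
      - δ ≤ gromovProduct (wordDist S) w x z) {y : ι → G}
    (hy : Subgroup.closure (Set.range y) = ⊤) {h : ℕ → G →* Γ} (hh : Function.Injective h)
    (e : (G ⧸ stableKernel h) ≃* L) :
    ∃ (T : Type u) (_ : MetricSpace T) (_ : MulAction L T) (b : T), IsRealTree T ∧
      IsIsometricSMul L T ∧
      (∀ g : G, Tendsto (fun i => (wordLength S (h i g) : ℝ) / totalLength S y (h i))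
        (hyperfilter ℕ : Filter ℕ) (𝓝 (dist b (e (QuotientGroup.mk g) • b)))) ∧
      ∀ t : T, ∃ x : ℕ → Γ, Tendsto (fun i => wordDist S 1 (x i) / totalLength S y (h i))
          (hyperfilter ℕ : Filter ℕ) (𝓝 (dist b t)) ∧
        ∀ g : G, Tendsto (fun i => wordDist S (x i) (h i g * x i) / totalLength S y (h i))
          (hyperfilter ℕ : Filter ℕ) (𝓝 (dist t (e (QuotientGroup.mk g) • t))) := by
  let _ := wordPseudoMetricSpace hS
  have hdist : ∀ a b : Γ, dist a b = wordDist S a b := fun _ _ => rfl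
  have : IsIsometricSMul Γ Γ :=
    ⟨fun g => Isometry.of_dist_eq fun a b => wordDist_mul_left g a b⟩
  set r : ℕ → ℕ := fun i => totalLength S y (h i) with hr
  have hrt := tendsto_totalLength hS hy hh
  have hb : ∀ g, ∃ C : ℝ, ∀ i, dist 1 (h i g • (1 : Γ)) / r i ≤ C := by
    intro g
    obtain ⟨C, hC⟩ := exists_wordLength_div_totalLength_le hS hy h g
    exact ⟨C, fun i => by simpa [hdist, wordDist] using hC i⟩
  obtain ⟨act, hiso, hact⟩ := Cone.exists_quotient_action hb e
  let b : ScaledSeq (1 : Γ) r := ⟨fun _ => 1, 0, fun i => by simp⟩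
  have : Nonempty (Cone (1 : Γ) r) := ⟨SeparationQuotient.mk b⟩
  have hgeo : ∀ a c : Γ, ∃ (n : ℕ) (p : ℕ → Γ), dist a c = n ∧ p 0 = a ∧ p n = c ∧
      ∀ i j, i ≤ j → j ≤ n → dist (p i) (p j) = j - i := by
    intro a c
    obtain ⟨p, hp0, hp1, hp⟩ := exists_discrete_geodesic_from_one hS (a⁻¹ * c)
    refine ⟨_, fun i => a * p i, rfl, by simp [hp0], by simp [hp1], fun i j hij hj => ?_⟩
    rw [hdist, wordDist_mul_left, wordDist, hp i j hij hj, Nat.cast_sub hij]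
  refine ⟨Cone (1 : Γ) r, inferInstance, act, SeparationQuotient.mk b,
    isRealTree_of_four_point (Cone.four_point (four_point_wordDist hδ) hrt)
      (Cone.exists_isGeodesicSegment hgeo hrt), hiso, fun g => ?_, fun t => ?_⟩
  · rw [hact, SeparationQuotient.dist_mk]
    refine (b.tendsto_dist (b.twist hb g)).congr fun i => ?_
    simp [b, ScaledSeq.twist, hdist, wordDist, hr]
  · obtain ⟨x, rfl⟩ := SeparationQuotient.surjective_mk t
    refine ⟨x.seq, ?_, fun g => ?_⟩
    · rw [SeparationQuotient.dist_mk]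
      exact b.tendsto_dist x
    · rw [hact, SeparationQuotient.dist_mk]
      exact x.tendsto_dist (x.twist hb g)

end LimitTree

/-! ### Fixed points of the limit actions -/

section LimitGroups

variable {Γ : Type u} [Group Γ] {L : Type v} [Group L]

theorem IsStrictLimitGroup.exists_action (hyp : IsHyperbolicGroup Γ)
    (hL : IsStrictLimitGroup Γ L) :
    ∃ (T : Type u) (_ : MetricSpace T) (_ : MulAction L T),
      IsRealTree T ∧ IsIsometricSMul L T ∧ ¬ (∃ x : T, ∀ g : L, g • x = x) := by
  obtain ⟨S, hS, δ, hδ⟩ := hyp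
  obtain ⟨n, E, h, -, hconj, ⟨e⟩⟩ := hL
  set y : Fin n → PresentedGroup E := PresentedGroup.of
  have hy : Subgroup.closure (Set.range y) = ⊤ := PresentedGroup.closure_range_of E
  let c : ℕ → Γ → PresentedGroup E →* Γ := fun i γ => (MulAut.conj γ).toMonoidHom.comp (h i)
  have hc : ∀ i γ g, c i γ g = γ * h i g * γ⁻¹ := fun _ _ _ => rfl
  -- Total lengths are natural numbers, so a shortest conjugate exists.
  have hmin : ∀ i, ∃ γ, ∀ γ', totalLength S y (c i γ) ≤ totalLength S y (c i γ') := fun i =>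
    ⟨_, fun γ' => Function.argmin_le (fun γ => totalLength S y (c i γ)) γ'⟩
  choose γ hγ using hmin
  set h' : ℕ → PresentedGroup E →* Γ := fun i => c i (γ i) with hh'
  have hinj : Function.Injective h' := by
    intro i j hij
    by_contra hne
    refine hconj i j hne ⟨(γ j)⁻¹ * γ i, fun g => ?_⟩
    have hg : γ i * h i g * (γ i)⁻¹ = γ j * h j g * (γ j)⁻¹ := DFunLike.congr_fun hij g
    calc h j g = (γ j)⁻¹ * (γ j * h j g * (γ j)⁻¹) * γ j := by group
      _ = (γ j)⁻¹ * γ i * h i g * ((γ j)⁻¹ * γ i)⁻¹ := by rw [← hg]; group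
  have hker : stableKernel h' = stableKernel h := by
    ext g
    change (∀ᶠ i in atTop, h' i g = 1) ↔ ∀ᶠ i in atTop, h i g = 1
    simp only [hh', hc, conj_eq_one_iff]
  have hr := tendsto_totalLength hS hy hinj
  obtain ⟨T, _, _, b, hT, hiso, -, ht⟩ := exists_limit_tree hS hδ hy hinj
    ((QuotientGroup.quotientMulEquivOfEq hker).trans e)
  refine ⟨T, inferInstance, inferInstance, hT, hiso, ?_⟩
  rintro ⟨t, htfix⟩
  obtain ⟨x, -, hx⟩ := ht t
  have h0 := tendsto_finsetSum Finset.univ fun j (_ : j ∈ Finset.univ) => hx (y j)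
  simp only [htfix, dist_self, Finset.sum_const_zero] at h0
  refine zero_lt_one.not_ge (ge_of_tendsto h0 ?_)
  filter_upwards [hr.eventually_gt_atTop 0] with i hi
  rw [← Finset.sum_div, le_div_iff₀ hi, one_mul]
  -- The displacements at x_i sum to the total length of the conjugate of h'_i by x_i⁻¹, which by
  -- minimality is at least r_i; the quotients therefore stay ≥ 1 and cannot tend to 0.
  refine (Nat.cast_le.2 (hγ i ((x i)⁻¹ * γ i))).trans (le_of_eq ?_)
  rw [totalLength, Nat.cast_sum]
  refine Finset.sum_congr rfl fun j _ => ?_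
  rw [wordDist, hc, hh', hc]
  congr 2
  group

/-- A hyperbolic group with trivial centre yields actions of restricted limit groups. -/
theorem IsStrictRestrictedLimitGroup.exists_action (hyp : IsHyperbolicGroup Γ)
    (hcenter : ∀ z ∈ Subgroup.center Γ, z = 1) {k : ℕ} {a : Fin k → Γ}
    (ha : Subgroup.closure (Set.range a) = ⊤) {C : Subgroup L}
    (hL : IsStrictRestrictedLimitGroup a L C) :
    ∃ (T : Type u) (_ : MetricSpace T) (_ : MulAction L T),
      IsRealTree T ∧ IsIsometricSMul L T ∧ ¬ (∃ x : T, ∀ g : L, g • x = x) ∧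
        ∃ x : T, ∀ c ∈ C, c • x = x := by
  obtain ⟨S, hS, δ, hδ⟩ := hyp
  obtain ⟨n, E, h, hha, -, hne, e, rfl⟩ := hL
  set y : Fin n ⊕ Fin k → PresentedGroup E := PresentedGroup.of with hydef
  have hy : Subgroup.closure (Set.range y) = ⊤ := PresentedGroup.closure_range_of E
  have hh : Function.Injective h := fun i j hij => by_contra fun hij' => hne i j hij' hij
  have hr := tendsto_totalLength hS hy hh
  obtain ⟨T, _, _, b, hT, hiso, hb, ht⟩ := exists_limit_tree hS hδ hy hh e
  have hbase : ¬ ∀ g : L, g • b = b := by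
    intro hfix
    have h0 := tendsto_finsetSum Finset.univ fun j (_ : j ∈ Finset.univ) => hb (y j)
    simp only [hfix, dist_self, Finset.sum_const_zero] at h0
    refine zero_ne_one (tendsto_nhds_unique h0 (tendsto_const_nhds.congr' ?_))
    filter_upwards [hr.eventually_gt_atTop 0] with i hi
    rw [← Finset.sum_div, ← Nat.cast_sum]
    exact (div_self hi.ne').symm
  refine ⟨T, inferInstance, inferInstance, hT, hiso, ?_, b, ?_⟩
  · rintro ⟨t, htfix⟩
    obtain ⟨x, hx1, hx2⟩ := ht t
    simp only [htfix, dist_self] at hx2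
    have hpos : 0 < dist b t := by
      rw [dist_pos]
      rintro rfl
      exact hbase htfix
    obtain ⟨z, hz, hz1⟩ := exists_mem_center_ne_one hS hδ ha (fun R => by
      -- With d = d(b, t), eventually |x_i| > (d/2) r_i while each a_m moves x_i by less than (d/4)
      -- r_i; the surplus (d/4) r_i exceeds any given R.
      have hev : ∀ᶠ i in (hyperfilter ℕ : Filter ℕ), ∀ m : Fin k,
          wordDist S (x i) (h i (y (Sum.inr m)) * x i) / totalLength S y (h i) < dist b t / 4 :=
        eventually_all.2 fun m => (hx2 _).eventually_lt_const (by linarith)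
      obtain ⟨i, h1, h2, h3, h4⟩ := ((hx1.eventually_const_lt (half_lt_self hpos)).and
        (hev.and ((hr.eventually_gt_atTop 0).and
          (hr.eventually_ge_atTop (R / (dist b t / 4)))))).exists
      rw [lt_div_iff₀ h3] at h1
      rw [div_le_iff₀ (by linarith)] at h4
      have h5 := mul_pos hpos h3
      refine ⟨x i, by linarith, fun m => ?_⟩
      have h6 := h2 m
      rw [div_lt_iff₀ h3, hydef, hha] at h6
      linarith)
    exact hz1 (hcenter z hz)
  · suffices hle : ((coefficientSubgroup E).map (QuotientGroup.mk' (stableKernel h))).map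
        e.toMonoidHom ≤ MulAction.stabilizer L b from fun c hc => hle hc
    rw [Subgroup.map_le_iff_le_comap, Subgroup.map_le_iff_le_comap, coefficientSubgroup,
      Subgroup.closure_le]
    rintro _ ⟨m, rfl⟩
    change e (QuotientGroup.mk (y (Sum.inr m))) • b = b
    rw [eq_comm, ← dist_eq_zero]
    refine tendsto_nhds_unique (hb (y (Sum.inr m))) ?_
    have hm : ∀ i, h i (y (Sum.inr m)) = a m := fun i => hha i m
    simp only [hm]
    exact hr.const_div_atTop _

end LimitGroups

theorem propositionp {Γ : Type u} [Group Γ] (hyp : IsHyperbolicGroup Γ)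
    (htf : IsTorsionFreeGroup Γ) (hne : ¬ IsElementaryGroup Γ) :
    (∀ (L : Type v) [Group L], IsStrictLimitGroup Γ L →
      ∃ (T : Type u) (_ : MetricSpace T) (_ : MulAction L T),
        IsRealTree T ∧ IsIsometricSMul L T ∧ ¬ (∃ x : T, ∀ g : L, g • x = x)) ∧
    (∀ (k : ℕ) (a : Fin k → Γ), Subgroup.closure (Set.range a) = ⊤ →
      ∀ (L : Type v) [Group L] (C : Subgroup L), IsStrictRestrictedLimitGroup a L C →
        ∃ (T : Type u) (_ : MetricSpace T) (_ : MulAction L T),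
          IsRealTree T ∧ IsIsometricSMul L T ∧ ¬ (∃ x : T, ∀ g : L, g • x = x) ∧
            ∃ x : T, ∀ c ∈ C, c • x = x) := by

  have hcenter : ∀ z ∈ Subgroup.center Γ, z = 1 := fun z hz =>
    by_contra fun hz1 => hne (isElementaryGroup_of_mem_center hyp htf hz hz1)
  exact ⟨fun L _ hL => hL.exists_action hyp,
    fun k a ha L _ C hL => hL.exists_action hyp hcenter ha⟩
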